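/- Let $G$ be a locally compact Hausdorff group with left Haar measure $m$, let $L^1(G)=L^1(G,m)$ be its complex group algebra, and let $M(G)$ be the measure algebra of regular complex Borel measures on $G$, where the convolution of $\mu,\nu\in M(G)$ is given by $(\mu*\nu)(f)=\int_G\int_G f(xy)\,d\mu(x)\,d\nu(y)$ for $f\in C_0(G)$. Identify $\varphi\in L^1(G)$ with the measure $\varphi\,dm\in M(G)$, so that $L^1(G)$ is a closed ideal of $M(G)$. Let $\alpha\colon L^1(G)\to L^1(G)$ be a continuous surjective algebra homomorphism, let $\mu\in M(G)$ be non-zero, and define $\Lambda_{\mu,\alpha}\colon L^1(G)\to L^1(G)$ by $\Lambda_{\mu,\alpha}(\varphi)=\mu*\alpha(\varphi)$. Then the following assertions are equivalent: (a) $\Lambda_{\mu,\alpha}$ is a compact operator on $L^1(G)$; (b) $\Lambda_{\mu,\alpha}$ is a weakly compact operator on $L^1(G)$, i.e. it maps the closed unit ball to a relatively weakly compact set; (c) $G$ is compact and $\mu\in L^1(G)$, i.e. $\mu=\varphi\,dm$ for some $\varphi\in L^1(G)$. -/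

import Mathlib

open MeasureTheory

namespace GroupAlgebra

/-- A complex measure has finite total variation. -/
theorem isFiniteMeasure_variation {X : Type*} [MeasurableSpace X] (μ : ComplexMeasure X) :
    IsFiniteMeasure μ.variation := by
  have h1 : μ.variation ≤ (ComplexMeasure.re μ).variation + (ComplexMeasure.im μ).variation := by
    apply VectorMeasure.variation_le_of_forall_enorm_le
    intro E hE
    rw [Measure.add_apply]
    grw [← VectorMeasure.enorm_measure_le_variation, ← VectorMeasure.enorm_measure_le_variation]
    have : μ E = ((ComplexMeasure.re μ E : ℝ) : ℂ) +
        ((ComplexMeasure.im μ E : ℝ) : ℂ) * Complex.I := by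
      exact (Complex.re_add_im (μ E)).symm
    rw [this]
    refine (enorm_add_le _ _).trans (le_of_eq ?_)
    simp [← ofReal_norm]
  have h2 (s : SignedMeasure X) : IsFiniteMeasure s.variation := by
    rw [← SignedMeasure.totalVariation_eq_variation, SignedMeasure.totalVariation]
    infer_instance
  have := h2 (ComplexMeasure.re μ)
  have := h2 (ComplexMeasure.im μ)
  exact isFiniteMeasure_of_le _ h1

variable {G : Type*} [Group G] [TopologicalSpace G] [IsTopologicalGroup G]
  [MeasurableSpace G] [BorelSpace G]

/-- `L¹(G)`: classes of complex functions integrable for the left Haar measure `m`. -/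
abbrev L1 (m : Measure G) : Type _ := Lp ℂ 1 m

/-- A complex Borel measure belongs to the measure algebra `M(G)` if it is regular, i.e. if its
total variation is a regular measure. -/
def MemM (μ : ComplexMeasure G) : Prop := μ.variation.Regular

/-- The canonical embedding `L¹(G) → M(G)`, sending `φ` to the measure `φ dm`, that is
`E ↦ ∫_E φ dm`. -/
noncomputable def toM (m : Measure G) (φ : L1 m) : ComplexMeasure G := m.withDensityᵥ φ

/-- Left translation on `L¹(G)`: `(L_x φ)(y) = φ (x⁻¹ y)`. -/
noncomputable def leftTranslate (m : Measure G) [m.IsMulLeftInvariant] (x : G) (φ : L1 m) : L1 m :=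
  Lp.compMeasurePreserving (fun y : G => x⁻¹ * y) (measurePreserving_mul_left m x⁻¹) φ

/-- The pairing `(v, c) ↦ c • v` of a complex normed space with `ℂ`; the integral of a vector-valued
function `F` against a complex measure `μ`, namely `∫ F dμ`, is taken with respect to it. -/
noncomputable def smulPairing (E : Type*) [NormedAddCommGroup E] [NormedSpace ℂ E] :
    E →L[ℝ] ℂ →L[ℝ] E :=
  (ContinuousLinearMap.lsmul ℝ ℂ).flip

/-- The convolution `μ * φ ∈ L¹(G)` of `μ ∈ M(G)` and `φ ∈ L¹(G)`, as the `L¹(G)`-valued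
integral `∫ L_x φ dμ(x)`, i.e. `(μ * φ)(y) = ∫ φ (x⁻¹ y) dμ(x)`. The integral converges by
`integrable_leftTranslate`, and `integral_mul_conv` says that the measure `(μ * φ) dm` is the
convolution of the measures `μ` and `φ dm`. -/
noncomputable def conv (m : Measure G) [m.IsMulLeftInvariant] (μ : ComplexMeasure G) (φ : L1 m) :
    L1 m :=
  μ.integral (fun x => leftTranslate m x φ) (smulPairing (L1 m))

/-- The product `φ * ψ` of `L¹(G)`, which is the one of `M(G)`: `φ * ψ = (φ dm) * ψ`. -/
noncomputable def mul (m : Measure G) [m.IsMulLeftInvariant] (φ ψ : L1 m) : L1 m :=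
  conv m (toM m φ) ψ

/-- A continuous epimorphism of `L¹(G)`: a continuous surjective algebra homomorphism. -/
structure IsContinuousEpimorphism (m : Measure G) [m.IsMulLeftInvariant]
    (α : L1 m →ₗ[ℂ] L1 m) : Prop where
  continuous : Continuous α
  map_mul : ∀ φ ψ : L1 m, α (mul m φ ψ) = mul m (α φ) (α ψ)
  surjective : Function.Surjective α

/-- The map `Λ_{μ, α} : L¹(G) → L¹(G)`, `φ ↦ μ * α(φ)`. -/
noncomputable def Lam (m : Measure G) [m.IsMulLeftInvariant] (μ : ComplexMeasure G)
    (α : L1 m →ₗ[ℂ] L1 m) (φ : L1 m) : L1 m :=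
  conv m μ (α φ)

/-- A map between complex normed spaces is weakly compact if the image of the closed unit ball is
relatively compact in the weak topology. -/
def IsWeaklyCompactOperator {E F : Type*} [NormedAddCommGroup E] [NormedSpace ℂ E]
    [NormedAddCommGroup F] [NormedSpace ℂ F] (T : E → F) : Prop :=
  IsCompact (closure ((fun v => toWeakSpace ℂ F (T v)) '' Metric.closedBall (0 : E) 1))

/-! Facts showing that the definitions are meaningful. -/

theorem continuous_leftTranslate [LocallyCompactSpace G] (m : Measure G) [m.IsHaarMeasure]
    [m.Regular] (φ : L1 m) : Continuous fun x => leftTranslate m x φ := by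
  have : Fact ((1 : ENNReal) ≠ ⊤) := ⟨by simp⟩
  have h : Continuous fun x : G => (DomMulAct.mk x⁻¹ : Gᵈᵐᵃ) • φ := by
    have : Continuous fun x : G => (DomMulAct.mk x⁻¹ : Gᵈᵐᵃ) :=
      DomMulAct.continuous_mk.comp continuous_inv
    exact this.smul continuous_const
  exact h

theorem norm_leftTranslate (m : Measure G) [m.IsMulLeftInvariant] (x : G) (φ : L1 m) :
    ‖leftTranslate m x φ‖ = ‖φ‖ :=
  Lp.norm_compMeasurePreserving _ _

theorem integrable_leftTranslate [LocallyCompactSpace G] [T2Space G] (m : Measure G)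
    [m.IsHaarMeasure] [m.Regular] {μ : ComplexMeasure G} (hμ : MemM μ) (φ : L1 m) :
    μ.Integrable fun x => leftTranslate m x φ := by
  have hfin := isFiniteMeasure_variation μ
  have hreg : μ.variation.Regular := hμ
  refine ⟨?_, ?_⟩
  · obtain ⟨K, hK⟩ : ∃ K : ℕ → Set G, ∀ n, IsCompact (K n) ∧
        μ.variation (Set.univ \ K n) < ((n : ENNReal) + 1)⁻¹ := by
      have : ∀ n : ℕ, ∃ K : Set G, IsCompact K ∧
          μ.variation (Set.univ \ K) < ((n : ENNReal) + 1)⁻¹ := by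
        intro n
        obtain ⟨K, -, hK, hK'⟩ := MeasurableSet.univ.exists_isCompact_sdiff_lt
          (μ := μ.variation) (measure_ne_top _ _) (ε := ((n : ENNReal) + 1)⁻¹) (by simp)
        exact ⟨K, hK, hK'⟩
      exact ⟨fun n => (this n).choose, fun n => (this n).choose_spec⟩
    have hnull : μ.variation (⋃ n, K n)ᶜ = 0 := by
      have hle : ∀ n : ℕ, μ.variation (⋃ n, K n)ᶜ ≤ ((n : ENNReal))⁻¹ := by
        intro n
        calc μ.variation (⋃ n, K n)ᶜ ≤ μ.variation (Set.univ \ K n) := by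
              apply measure_mono
              intro x hx
              exact ⟨trivial, fun h => hx (Set.mem_iUnion_of_mem n h)⟩
          _ ≤ ((n : ENNReal) + 1)⁻¹ := (hK n).2.le
          _ ≤ ((n : ENNReal))⁻¹ := ENNReal.inv_le_inv.2 le_self_add
      exact le_antisymm (ge_of_tendsto' ENNReal.tendsto_inv_nat_nhds_zero hle) (zero_le)
    have hrestr : μ.variation.restrict (⋃ n, K n) = μ.variation :=
      Measure.restrict_eq_self_of_ae_mem (mem_ae_iff.2 hnull)
    rw [← hrestr, aestronglyMeasurable_iUnion_iff]
    intro n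
    exact (continuous_leftTranslate m φ).continuousOn.aestronglyMeasurable_of_isCompact
      (hK n).1 (hK n).1.measurableSet
  · refine HasFiniteIntegral.of_bounded (C := ‖φ‖) (ae_of_all _ fun x => ?_)
    rw [norm_leftTranslate]

/-- The measure `φ dm` is regular: `L¹(G)` embeds in `M(G)`. -/
theorem memM_toM [LocallyCompactSpace G] [T2Space G] (m : Measure G) [m.IsHaarMeasure]
    [m.Regular] (φ : L1 m) : MemM (toM m φ) := by
  have hint : Integrable φ m := L1.integrable_coeFn φ
  have hvar : (toM m φ).variation = m.withDensity fun x => ‖φ x‖ₑ :=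
    Measure.variation_withDensityᵥ hint
  have hfin := isFiniteMeasure_variation (toM m φ)
  have hmeas : Measurable fun x => ‖φ x‖ₑ := (Lp.stronglyMeasurable φ).enorm
  have hlt : ∫⁻ x, ‖φ x‖ₑ ∂m ≠ ⊤ := hint.2.ne
  have : (toM m φ).variation.InnerRegularCompactLTTop := by
    constructor
    rintro A ⟨hA, -⟩ r hr
    set S : ℕ → Set G := fun n => {x | ((n : ENNReal) + 1)⁻¹ ≤ ‖φ x‖ₑ} with hS
    have hSm : ∀ n, MeasurableSet (S n) := fun n => measurableSet_le measurable_const hmeas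
    have hSmono : Monotone S := by
      intro a b hab x hx
      refine le_trans (ENNReal.inv_le_inv.2 ?_) hx
      gcongr
    have hSfin : ∀ n, m (S n) ≠ ⊤ := fun n =>
      ((meas_ge_le_lintegral_div hmeas.aemeasurable (by simp) (by simp)).trans_lt
        (ENNReal.div_lt_top hlt (by simp))).ne
    have hunion : (toM m φ).variation (⋃ n, A ∩ S n) = (toM m φ).variation A := by
      apply measure_congr
      rw [hvar]
      have hz : ∀ᵐ x ∂(m.withDensity fun x => ‖φ x‖ₑ), ‖φ x‖ₑ ≠ 0 := by
        rw [ae_withDensity_iff hmeas]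
        exact ae_of_all _ fun x hx => hx
      filter_upwards [hz] with x hx
      apply propext
      change x ∈ (⋃ n, A ∩ S n) ↔ x ∈ A
      rw [← Set.inter_iUnion]
      refine ⟨fun h => h.1, fun h => ⟨h, ?_⟩⟩
      obtain ⟨n, hn⟩ := ENNReal.exists_inv_nat_lt hx
      exact Set.mem_iUnion_of_mem n ((ENNReal.inv_le_inv.2 le_self_add).trans hn.le)
    rw [← hunion, Monotone.measure_iUnion
      (fun a b hab => Set.inter_subset_inter_right A (hSmono hab))] at hr
    obtain ⟨n, hn⟩ := lt_iSup_iff.1 hr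
    have hAS : m (A ∩ S n) ≠ ⊤ := ((measure_mono Set.inter_subset_right).trans_lt
      (hSfin n).lt_top).ne
    obtain ⟨δ, hδ, hδ'⟩ := exists_pos_setLIntegral_lt_of_measure_lt hlt
      (tsub_pos_of_lt hn).ne'
    obtain ⟨K, hKA, hK, hKδ⟩ := (hA.inter (hSm n)).exists_isCompact_sdiff_lt hAS hδ.ne'
    refine ⟨K, hKA.trans Set.inter_subset_left, hK, ?_⟩
    have h1 := hδ' _ hKδ
    rw [← withDensity_apply _ ((hA.inter (hSm n)).diff hK.measurableSet), ← hvar] at h1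
    have h2 : (toM m φ).variation (A ∩ S n) ≤
        (toM m φ).variation K + (toM m φ).variation ((A ∩ S n) \ K) := by
      rw [← measure_union Set.disjoint_sdiff_right
        ((hA.inter (hSm n)).diff hK.measurableSet)]
      apply measure_mono
      rw [Set.union_sdiff_self]
      exact Set.subset_union_right
    by_contra! hcon
    have h3 : (toM m φ).variation (A ∩ S n) < r + ((toM m φ).variation (A ∩ S n) - r) :=
      h2.trans_lt (ENNReal.add_lt_add_of_le_of_lt (measure_ne_top _ _) hcon h1)
    rw [add_tsub_cancel_of_le hn.le] at h3
    exact lt_irrefl _ h3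
  unfold MemM
  infer_instance

theorem integral_mul_conv [LocallyCompactSpace G] [T2Space G] (m : Measure G) [m.IsHaarMeasure]
    [m.Regular] {μ : ComplexMeasure G} (hμ : MemM μ) (φ : L1 m)
    (f : ZeroAtInftyContinuousMap G ℂ) :
    ∫ z, f z * conv m μ φ z ∂m =
      μ.integral (fun x => ∫ y, f (x * y) * φ y ∂m) (smulPairing ℂ) := by
  have hf : ∀ ψ : L1 m, Integrable (fun z => f z * ψ z) m := fun ψ =>
    (L1.integrable_coeFn ψ).bdd_mul (c := ‖f‖) (map_continuous f).aestronglyMeasurable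
      (ae_of_all _ fun x => f.toBCF.norm_coe_le_norm x)
  let C₀ : L1 m →ₗ[ℂ] ℂ :=
    { toFun := fun ψ => ∫ z, f z * ψ z ∂m
      map_add' := fun ψ χ => by
        rw [← integral_add (hf ψ) (hf χ)]
        refine integral_congr_ae ?_
        filter_upwards [Lp.coeFn_add ψ χ] with z hz
        rw [hz, Pi.add_apply, mul_add]
      map_smul' := fun c ψ => by
        simp only [RingHom.id_apply, smul_eq_mul]
        rw [← integral_const_mul]
        refine integral_congr_ae ?_
        filter_upwards [Lp.coeFn_smul c ψ] with z hz
        rw [hz, Pi.smul_apply, smul_eq_mul]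
        ring }
  let C : L1 m →L[ℂ] ℂ := C₀.mkContinuous ‖f‖ fun ψ => by
    rw [L1.norm_eq_integral_norm, ← integral_const_mul]
    refine norm_integral_le_of_norm_le ((L1.integrable_coeFn ψ).norm.const_mul _)
      (ae_of_all _ fun z => ?_)
    rw [norm_mul]
    gcongr
    exact f.toBCF.norm_coe_le_norm z
  have hint := integrable_leftTranslate m hμ φ
  have key := VectorMeasure.continuousLinearMap_apply_integral (B := smulPairing (L1 m))
    (C := C.restrictScalars ℝ) hint
  have hB : (ContinuousLinearMap.compL ℝ ℂ (L1 m) ℂ (C.restrictScalars ℝ)) ∘L smulPairing (L1 m) =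
      smulPairing ℂ ∘L C.restrictScalars ℝ := by
    apply ContinuousLinearMap.ext
    intro ψ
    apply ContinuousLinearMap.ext
    intro c
    change C (c • ψ) = c • C ψ
    exact map_smul C c ψ
  refine key.trans ((congrArg (fun B => μ.integral (fun x => leftTranslate m x φ) B) hB).trans
    ((VectorMeasure.integral_continuousLinearMap_comp hint).symm.trans ?_))
  congr 1
  ext x
  change ∫ z, f z * leftTranslate m x φ z ∂m = _
  rw [← integral_mul_left_eq_self (fun z => f z * leftTranslate m x φ z) x]
  refine integral_congr_ae ?_
  have h1 := (measurePreserving_mul_left m x).quasiMeasurePreserving.ae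
    (Lp.coeFn_compMeasurePreserving φ (measurePreserving_mul_left m x⁻¹))
  filter_upwards [h1] with y hy
  unfold leftTranslate
  rw [hy]
  simp

end GroupAlgebra

open MeasureTheory

namespace GroupAlgebra

section CompactMultipliers

open Filter Topology Set
open scoped ENNReal NNReal Pointwise

/-! ### Integration against complex measures and measures with density. -/

section Integration

variable {X : Type*} [MeasurableSpace X]
  {E : Type*} [NormedAddCommGroup E] [NormedSpace ℂ E]
  {F : Type*} [NormedAddCommGroup F] [NormedSpace ℂ F]

/-! Norm-compact sets are weakly compact, so a compact operator is weakly compact.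

If `G` is compact and `φ` is continuous, unimodularity gives `φ * ψ = ∫ ψ(y) φ(· y⁻¹) dm(y)`, an
integral of a continuous vector-valued kernel over a compact space. The image of the unit ball then
lies in a compact convex set (`isCompactOperator_integral_smul`). For general `φ ∈ L¹(G)`,
approximate by continuous functions: the operator norm of `φ * ·` is at most `‖φ‖`, and compact
operators are closed in operator norm. Composing with the bounded map `α` keeps compactness.

Conversely, let `Λ_{μ, α}` be weakly compact. By the open mapping theorem, bounded families lift
through the surjection `α` to bounded families, so `μ * φ_i` has a weak limit along some ultrafilter
whenever the `φ_i` are bounded (`exists_ultrafilter_tendsto`). This is used twice. Along an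
approximate identity, a weak limit `h` of `μ * φ` satisfies `h dm = μ` (`exists_toM_eq`). For the
other use, choose `φ` with `F = μ * φ ≠ 0`. Left convolution commutes with right translation, so
every sequence of normalized right translates of `F` has a weak limit along an ultrafilter. If `G`
were not compact, the translates could be sent to almost disjoint places, and a weak limit would
keep a fixed amount of mass on sets decreasing to `∅` (`compactSpace_of_forall_exists_ultrafilter`).
-/

@[simp] theorem smulPairing_apply (v : E) (c : ℂ) : smulPairing E v c = c • v := rfl

theorem norm_smulPairing_le : ‖smulPairing E‖ ≤ 1 := by
  refine ContinuousLinearMap.opNorm_le_bound₂ _ zero_le_one fun v c => ?_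
  rw [smulPairing_apply, norm_smul, one_mul, mul_comm]

/-- Complex-linear maps commute with integrals against a complex measure. -/
theorem clm_apply_integral [CompleteSpace E] [CompleteSpace F] (C : E →L[ℂ] F) {μ : ComplexMeasure X} {g : X → E}
    (hg : μ.Integrable g) :
    C (μ.integral g (smulPairing E)) = μ.integral (fun x => C (g x)) (smulPairing F) := by
  have key := VectorMeasure.continuousLinearMap_apply_integral (B := smulPairing E)
    (C := C.restrictScalars ℝ) hg
  have hB : (ContinuousLinearMap.compL ℝ ℂ E F (C.restrictScalars ℝ)) ∘L smulPairing E =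
      smulPairing F ∘L C.restrictScalars ℝ := by
    apply ContinuousLinearMap.ext
    intro v
    apply ContinuousLinearMap.ext
    intro c
    exact map_smul C c v
  exact key.trans ((congrArg (fun B => μ.integral g B) hB).trans
    (VectorMeasure.integral_continuousLinearMap_comp hg).symm)

theorem norm_integral_smulPairing_le {μ : ComplexMeasure X} (g : X → E) :
    ‖μ.integral g (smulPairing E)‖ ≤ ∫ x, ‖g x‖ ∂μ.variation :=
  (VectorMeasure.norm_integral_le_integral_norm).trans
    (mul_le_of_le_one_left (integral_nonneg fun _ => norm_nonneg _) norm_smulPairing_le)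

theorem integrable_smul_of_bounded {m : Measure X} {g : X → E} (hg : AEStronglyMeasurable g m)
    {C : ℝ} (hC : ∀ x, ‖g x‖ ≤ C) (φ : Lp ℂ 1 m) : Integrable (fun x => φ x • g x) m :=
  (L1.integrable_coeFn φ).smul_bdd C hg (ae_of_all _ hC)

theorem norm_integral_smul_le {m : Measure X} {g : X → E}
    {C : ℝ} (hC : ∀ x, ‖g x‖ ≤ C) (φ : Lp ℂ 1 m) :
    ‖∫ x, φ x • g x ∂m‖ ≤ C * ‖φ‖ := by
  rw [L1.norm_eq_integral_norm, ← integral_const_mul]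
  refine norm_integral_le_of_norm_le ((L1.integrable_coeFn φ).norm.const_mul _)
    (ae_of_all _ fun z => ?_)
  rw [norm_smul, mul_comm]
  gcongr
  exact hC z

/-- The operator `φ ↦ ∫ φ g dm` on `L¹`, for a bounded measurable function `g`. -/
noncomputable def integralSMul {m : Measure X} {g : X → E} (hg : AEStronglyMeasurable g m)
    {C : ℝ} (hC : ∀ x, ‖g x‖ ≤ C) : Lp ℂ 1 m →L[ℂ] E :=
  LinearMap.mkContinuous
    { toFun := fun φ => ∫ x, φ x • g x ∂m
      map_add' := fun φ ψ => by
        rw [← integral_add (integrable_smul_of_bounded hg hC φ)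
          (integrable_smul_of_bounded hg hC ψ)]
        refine integral_congr_ae ?_
        filter_upwards [Lp.coeFn_add φ ψ] with z hz
        rw [hz, Pi.add_apply, add_smul]
      map_smul' := fun c φ => by
        rw [RingHom.id_apply, ← integral_smul]
        refine integral_congr_ae ?_
        filter_upwards [Lp.coeFn_smul c φ] with z hz
        rw [hz, Pi.smul_apply, smul_eq_mul, mul_smul] } C fun φ => norm_integral_smul_le hC φ

theorem integralSMul_apply {m : Measure X} {g : X → E} (hg : AEStronglyMeasurable g m)
    {C : ℝ} (hC : ∀ x, ‖g x‖ ≤ C) (φ : Lp ℂ 1 m) :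
    integralSMul hg hC φ = ∫ x, φ x • g x ∂m := rfl

/-- Integration against the complex measure with density `φ`. -/
theorem integral_withDensityᵥ [CompleteSpace E] (m : Measure X) {φ : X → ℂ} (hφ : Integrable φ m)
    (hφm : StronglyMeasurable φ) {g : X → E} (hg : (m.withDensityᵥ φ).Integrable g) :
    (m.withDensityᵥ φ).integral g (smulPairing E) = ∫ x, φ x • g x ∂m := by
  have hvar : (m.withDensityᵥ φ).variation = m.withDensity fun x => ‖φ x‖ₑ :=
    Measure.variation_withDensityᵥ hφ
  have hmeas : Measurable fun x => ‖φ x‖₊ := hφm.measurable.nnnorm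
  have hI : ∀ {f : X → E}, Integrable f (m.withDensityᵥ φ).variation →
      Integrable (fun x => φ x • f x) m := by
    intro f hf
    rw [hvar] at hf
    have h1 := (integrable_withDensity_iff_integrable_smul (μ := m) hmeas).1 hf
    have hs : AEStronglyMeasurable (fun x => φ x • f x) m := by
      -- Measurability of `f` is known only for `|φ| dm`, so it is read off from `‖φ‖ • f`; the
      -- measurable phase `φ / ‖φ‖` is multiplied back in.
      have h2 : (fun x => φ x • f x) =
          fun x => (φ x / (‖φ x‖ : ℂ)) • (‖φ x‖₊ • f x) := by
        funext x
        rw [NNReal.smul_def, coe_nnnorm, ← Complex.coe_smul, smul_smul]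
        by_cases h : φ x = 0
        · simp [h]
        · rw [div_mul_cancel₀]
          simpa using h
      rw [h2]
      refine AEStronglyMeasurable.smul ?_ h1.1
      exact (hφm.measurable.div
        (Complex.measurable_ofReal.comp hφm.measurable.norm)).aestronglyMeasurable
    refine h1.mono hs (ae_of_all _ fun x => ?_)
    rw [norm_smul, NNReal.smul_def, norm_smul, coe_nnnorm, norm_norm]
  refine hg.induction (P := fun f =>
    (m.withDensityᵥ φ).integral f (smulPairing E) = ∫ x, φ x • f x ∂m) ?_ ?_ ?_ ?_
  · intro c s hs hc
    have : IsFiniteMeasure ((m.withDensityᵥ φ).variation.restrict s) := ⟨by simpa⟩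
    rw [VectorMeasure.integral_indicator_const _ hs, smulPairing_apply,
      withDensityᵥ_apply hφ hs, ← integral_smul_const, ← integral_indicator hs]
    congr 1
    ext x
    by_cases hx : x ∈ s <;> simp [hx]
  · intro f g _ hf hg h1 h2
    rw [VectorMeasure.integral_add hf hg, h1, h2, ← integral_add (hI hf) (hI hg)]
    simp
  -- The right-hand side is 1-Lipschitz for the `L¹(|φ| dm)` norm. Representatives of `f - g` agree
  -- only where `φ ≠ 0`, which is all that the integrand sees.
  · refine isClosed_eq VectorMeasure.continuous_integral
      (LipschitzWith.of_dist_le_mul (K := 1) fun f g => ?_).continuous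
    have hf := L1.integrable_coeFn f
    have hg := L1.integrable_coeFn g
    have hae : ∀ᵐ x ∂m, φ x ≠ 0 → ‖(f - g) x‖ = ‖f x - g x‖ := by
      have hle : ae (m.withDensity fun x => ‖φ x‖ₑ) ≤ ae (m.withDensityᵥ φ).variation := by
        rw [hvar]
      filter_upwards [(ae_withDensity_iff hφm.measurable.enorm).1 (hle (Lp.coeFn_sub f g))]
        with x hx h0
      rw [hx (by simpa using h0), Pi.sub_apply]
    rw [dist_eq_norm, ← integral_sub (hI hf) (hI hg), NNReal.coe_one, one_mul, dist_eq_norm,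
      L1.norm_eq_integral_norm]
    have hw : ∀ k : X → ℝ, ∫ x, k x ∂(m.withDensityᵥ φ).variation =
        ∫ x, ‖φ x‖₊ • k x ∂m := fun k => by
      rw [← integral_withDensity_eq_integral_smul hmeas, hvar]
      rfl
    rw [hw]
    refine (norm_integral_le_integral_norm _).trans (integral_congr_ae ?_).le
    filter_upwards [hae] with x hx
    rw [← smul_sub, norm_smul, NNReal.smul_def, coe_nnnorm, smul_eq_mul]
    by_cases h : φ x = 0
    · simp [h]
    · rw [hx h]
  · intro f g hfg _ hf
    rw [← VectorMeasure.integral_congr_ae hfg, hf]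
    rw [hvar] at hfg
    have := (ae_withDensity_iff hφm.measurable.enorm).1 hfg
    refine integral_congr_ae ?_
    filter_upwards [this] with x hx
    by_cases h : φ x = 0
    · simp [h]
    · rw [hx (by simpa using h)]

end Integration

/-! ### Convolution by a measure as a bounded operator. -/

section Convolution

variable {G : Type*} [Group G] [TopologicalSpace G] [IsTopologicalGroup G]
  [MeasurableSpace G] [BorelSpace G] (m : Measure G) [m.IsHaarMeasure]

theorem leftTranslate_add (x : G) (φ ψ : L1 m) :
    leftTranslate m x (φ + ψ) = leftTranslate m x φ + leftTranslate m x ψ :=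
  map_add (Lp.compMeasurePreserving _ _) φ ψ

theorem leftTranslate_smul (x : G) (c : ℂ) (φ : L1 m) :
    leftTranslate m x (c • φ) = c • leftTranslate m x φ :=
  map_smul (Lp.compMeasurePreservingₗ ℂ _ (measurePreserving_mul_left m x⁻¹)) c φ

theorem coeFn_leftTranslate (x : G) (φ : L1 m) :
    leftTranslate m x φ =ᵐ[m] fun y => φ (x⁻¹ * y) :=
  Lp.coeFn_compMeasurePreserving φ (measurePreserving_mul_left m x⁻¹)

variable [LocallyCompactSpace G] [T2Space G] [m.Regular]

/-- The bounded operator `φ ↦ μ * φ` on `L¹(G)`. -/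
noncomputable def convCLM {μ : ComplexMeasure G} (hμ : MemM μ) : L1 m →L[ℂ] L1 m :=
  LinearMap.mkContinuous
    { toFun := conv m μ
      map_add' := fun φ ψ => by
        refine (congrArg (fun g => μ.integral g (smulPairing (L1 m)))
          (funext fun x => leftTranslate_add m x φ ψ)).trans ?_
        exact VectorMeasure.integral_fun_add (integrable_leftTranslate m hμ φ)
          (integrable_leftTranslate m hμ ψ)
      map_smul' := fun c φ => by
        have := clm_apply_integral (c • ContinuousLinearMap.id ℂ (L1 m))
          (integrable_leftTranslate m hμ φ)
        exact (congrArg (fun g => μ.integral g (smulPairing (L1 m)))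
          (funext fun x => leftTranslate_smul m x c φ)).trans this.symm } (μ.variation.real univ) fun φ => by
    refine (norm_integral_smulPairing_le _).trans ?_
    simp [norm_leftTranslate]

@[simp] theorem convCLM_apply {μ : ComplexMeasure G} (hμ : MemM μ) (φ : L1 m) :
    convCLM m hμ φ = conv m μ φ := rfl

theorem conv_toM (φ ψ : L1 m) :
    conv m (toM m φ) ψ = ∫ x, φ x • leftTranslate m x ψ ∂m :=
  integral_withDensityᵥ m (L1.integrable_coeFn φ) (Lp.stronglyMeasurable φ)
    (integrable_leftTranslate m (memM_toM m φ) ψ)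

end Convolution

/-! ### Compact groups: convolution by an `L¹` function is compact. -/

section Compact

/-- The continuous family `x ↦ (z ↦ φ (a x z))` of continuous functions. -/
theorem continuous_family {X : Type*} [TopologicalSpace X] (φ : C(X, ℂ)) {a : X → X → X}
    (ha : Continuous fun p : X × X => a p.1 p.2) :
    ∃ k : C(X, C(X, ℂ)), ∀ x z, k x z = φ (a x z) :=
  ⟨ContinuousMap.curry ⟨fun p => φ (a p.1 p.2), by fun_prop⟩, fun _ _ => rfl⟩

theorem aestronglyMeasurable_of_compactSpace {E : Type*} [NormedAddCommGroup E]
    {X : Type*} [TopologicalSpace X] [CompactSpace X]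
    [MeasurableSpace X] [BorelSpace X] (m : Measure X) {k : X → E} (hk : Continuous k) :
    AEStronglyMeasurable k m := by
  rw [← Measure.restrict_univ (μ := m)]
  exact hk.continuousOn.aestronglyMeasurable_of_isCompact isCompact_univ MeasurableSet.univ

variable {E : Type*} [NormedAddCommGroup E] [NormedSpace ℂ E] [CompleteSpace E]

/-- An operator on `L¹` of a compact space given by a continuous vector-valued kernel is
compact. -/
theorem isCompactOperator_integral_smul {X : Type*} [TopologicalSpace X] [CompactSpace X]
    [Nonempty X] [MeasurableSpace X] [BorelSpace X] (m : Measure X) [IsFiniteMeasure m] {k : X → E}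
    (hk : Continuous k) : IsCompactOperator (fun ψ : Lp ℂ 1 m => ∫ x, ψ x • k x ∂m) := by
  have hcont : Continuous fun p : ℂ × X => p.1 • k p.2 := by fun_prop
  -- The scalars of the closed unit disc make `S` balanced, so its convex hull contains the
  -- absolutely convex combinations of kernel values.
  set S : Set E := (fun p : ℂ × X => p.1 • k p.2) '' (Metric.closedBall 0 1 ×ˢ univ) with hS
  have hSc : IsCompact S :=
    ((isCompact_closedBall (0 : ℂ) 1).prod isCompact_univ).image hcont
  refine ⟨closure (convexHull ℝ S), ?_, ?_⟩
  · exact (hSc.totallyBounded.convexHull.closure).isCompact_of_isClosed isClosed_closure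
  · refine mem_of_superset (Metric.closedBall_mem_nhds 0 one_pos) fun ψ hψ => ?_
    obtain ⟨C, hC⟩ : ∃ C, ∀ x, ‖k x‖ ≤ C := by
      obtain ⟨C, hC⟩ := (isCompact_range hk).isBounded.exists_norm_le
      exact ⟨C, fun x => hC _ (mem_range_self x)⟩
    have hint := integrable_smul_of_bounded
      (aestronglyMeasurable_of_compactSpace m hk) hC ψ
    -- If the integral were outside the closed hull, a real functional `f` would separate them;
    -- integrating the pointwise bound `f (c • k x) ≤ ‖c‖ * u` with `c = ψ x` contradicts this.
    by_contra hcon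
    obtain ⟨f, u, hfu, hu⟩ := geometric_hahn_banach_closed_point
      ((convex_convexHull ℝ S).closure) isClosed_closure hcon
    have hfS : ∀ c : ℂ, ‖c‖ ≤ 1 → ∀ x, f (c • k x) < u := fun c hc x =>
      hfu _ (subset_closure (subset_convexHull ℝ S
        ⟨(c, x), ⟨by simpa using hc, mem_univ _⟩, rfl⟩))
    have hle : ∀ c : ℂ, ∀ x, f (c • k x) ≤ ‖c‖ * u := by
      intro c x
      by_cases hc : c = 0
      · simp [hc]
      · have h1 := hfS ((‖c‖ : ℂ)⁻¹ * c) (by simp [hc]) x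
        rw [mul_smul, ← Complex.ofReal_inv, Complex.coe_smul, map_smul, smul_eq_mul] at h1
        have h2 : 0 < ‖c‖ := norm_pos_iff.2 hc
        rw [inv_mul_lt_iff₀ h2] at h1
        exact h1.le
    have hu0 : 0 < u := by simpa using hfS 0 (by simp) (Classical.arbitrary X)
    have h3 : f (∫ x, ψ x • k x ∂m) ≤ ‖ψ‖ * u := by
      rw [← f.integral_comp_comm hint, L1.norm_eq_integral_norm, ← integral_mul_const]
      exact integral_mono (f.integrable_comp hint) ((L1.integrable_coeFn ψ).norm.mul_const _)
        fun x => hle _ x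
    have h4 : ‖ψ‖ ≤ 1 := by simpa using hψ
    have h5 : ‖ψ‖ * u ≤ u := mul_le_of_le_one_left hu0.le h4
    linarith

variable {G : Type*} [Group G] [TopologicalSpace G] [IsTopologicalGroup G] [CompactSpace G]
  [MeasurableSpace G] [BorelSpace G] (m : Measure G) [m.IsHaarMeasure]

/-- Uniqueness of Haar measure leaves one scalar, which the finite non-zero total mass fixes. -/
theorem eq_of_isMulLeftInvariant_of_measure_univ (m' : Measure G) [m'.IsMulLeftInvariant]
    [IsFiniteMeasure m'] (h : m' univ = m univ) : m' = m := by
  have h1 := Measure.isMulInvariant_eq_smul_of_compactSpace m' m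
  have h2 : (m'.haarScalarFactor m : ℝ≥0∞) * m univ = 1 * m univ := by
    conv_rhs => rw [one_mul, ← h, h1]
    rfl
  rw [ENNReal.mul_left_inj (NeZero.ne _) (measure_ne_top _ _)] at h2
  rw [h1, ENNReal.coe_eq_one.1 h2, one_smul]

/-- Compact groups are unimodular. -/
theorem isInvInvariant_of_compactSpace : m.IsInvInvariant := by
  have hr : m.IsMulRightInvariant := ⟨fun y => by
    have := (measurable_mul_const y).aemeasurable (μ := m)
    refine eq_of_isMulLeftInvariant_of_measure_univ m _ ?_
    rw [Measure.map_apply (measurable_mul_const y) MeasurableSet.univ, preimage_univ]⟩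
  -- Right invariance of `m` makes its image under inversion left invariant.
  refine ⟨eq_of_isMulLeftInvariant_of_measure_univ m _ ?_⟩
  rw [Measure.inv_apply, inv_univ]

theorem leftTranslate_toLp (φ : C(G, ℂ)) (x : G) {χ : C(G, ℂ)} (hχ : ∀ z, χ z = φ (x⁻¹ * z)) :
    leftTranslate m x (ContinuousMap.toLp 1 m ℂ φ) = ContinuousMap.toLp 1 m ℂ χ := by
  apply Lp.ext
  have h := (measurePreserving_mul_left m x⁻¹).quasiMeasurePreserving.ae
    (ContinuousMap.coeFn_toLp (p := 1) (𝕜 := ℂ) m φ)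
  filter_upwards [coeFn_leftTranslate m x (ContinuousMap.toLp 1 m ℂ φ),
    ContinuousMap.coeFn_toLp (p := 1) (𝕜 := ℂ) m χ, h] with z h1 h2 h3
  rw [h1, h2, h3, hχ]

variable [T2Space G]

/-- On a compact group, `φ * ψ` is an integral of right translates of `φ`. -/
theorem conv_toLp_toLp (φ ψ : C(G, ℂ)) {k : C(G, C(G, ℂ))} (hk : ∀ y z, k y z = φ (z * y⁻¹)) :
    conv m (toM m (ContinuousMap.toLp 1 m ℂ φ)) (ContinuousMap.toLp 1 m ℂ ψ) =
      ∫ y, (ContinuousMap.toLp 1 m ℂ ψ : L1 m) y • ContinuousMap.toLp 1 m ℂ (k y) ∂m := by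
  have := isInvInvariant_of_compactSpace m
  obtain ⟨l, hl⟩ := continuous_family ψ (a := fun x z => x⁻¹ * z) (by fun_prop)
  have hint : ∀ (φ : C(G, ℂ)) (k : C(G, C(G, ℂ))), Integrable (fun x => φ x • k x) m := by
    intro φ k
    have hc : Continuous fun x => φ x • k x := by fun_prop
    obtain ⟨C, hC⟩ := (isCompact_range hc).isBounded.exists_norm_le
    exact Integrable.of_bound (aestronglyMeasurable_of_compactSpace m hc) C
      (ae_of_all _ fun x => hC _ (mem_range_self x))
  -- Both integrals are pulled back to `C(G, ℂ)`, where they can be compared at each point `z`.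
  have hL : ∀ (φ : C(G, ℂ)) (k : C(G, C(G, ℂ))),
      ∫ x, (ContinuousMap.toLp 1 m ℂ φ : L1 m) x • ContinuousMap.toLp 1 m ℂ (k x) ∂m =
        (ContinuousMap.toLp 1 m ℂ (∫ x, φ x • k x ∂m) : L1 m) := by
    intro φ k
    rw [← ContinuousLinearMap.integral_comp_comm _ (hint φ k)]
    refine integral_congr_ae ?_
    filter_upwards [ContinuousMap.coeFn_toLp (p := 1) (𝕜 := ℂ) m φ] with x hx
    rw [hx, map_smul]
  have hev : ∀ (φ : C(G, ℂ)) (k : C(G, C(G, ℂ))) (z : G),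
      (∫ x, φ x • k x ∂m) z = ∫ x, φ x * k x z ∂m := by
    intro φ k z
    exact ((ContinuousMap.evalCLM ℂ z).integral_comp_comm (hint φ k)).symm
  rw [conv_toM, hL]
  simp_rw [fun x => leftTranslate_toLp m ψ x (hl x)]
  rw [hL]
  congr 1
  ext z
  rw [hev, hev]
  simp_rw [hl, hk]
  -- The substitutions `x ↦ z x` and then `x ↦ x⁻¹` turn `φ(x) ψ(x⁻¹ z)` into `φ(z x⁻¹) ψ(x)`.
  rw [← integral_mul_left_eq_self (fun x => φ x * ψ (x⁻¹ * z)) z,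
    ← integral_inv_eq_self (fun x => φ (z * x) * ψ ((z * x)⁻¹ * z))]
  refine integral_congr_ae (ae_of_all _ fun x => ?_)
  simp [mul_comm]

/-- The kernel formula holds for continuous `ψ` and extends to all of `L¹` by density, since both
sides are bounded in `ψ`. -/
theorem isCompactOperator_conv_toLp (φ : C(G, ℂ)) :
    IsCompactOperator (conv m (toM m (ContinuousMap.toLp 1 m ℂ φ))) := by
  obtain ⟨k, hk⟩ := continuous_family φ (a := fun y z => z * y⁻¹) (by fun_prop)
  have hkc : Continuous fun y => (ContinuousMap.toLp 1 m ℂ (k y) : L1 m) := by fun_prop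
  obtain ⟨C, hC⟩ := (isCompact_range hkc).isBounded.exists_norm_le
  let S := integralSMul (aestronglyMeasurable_of_compactSpace m hkc)
    fun x => hC _ (mem_range_self x)
  have hS : IsCompactOperator S := isCompactOperator_integral_smul m hkc
  have heq : convCLM m (memM_toM m (ContinuousMap.toLp 1 m ℂ φ)) = S := by
    refine ContinuousLinearMap.ext fun ψ => ?_
    refine (ContinuousMap.toLp_denseRange ℂ m ℂ
      ENNReal.one_ne_top).induction_on ψ (isClosed_eq (by fun_prop) (by fun_prop)) fun ψ => ?_
    exact conv_toLp_toLp m φ ψ hk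
  have : conv m (toM m (ContinuousMap.toLp 1 m ℂ φ)) =
    convCLM m (memM_toM m (ContinuousMap.toLp 1 m ℂ φ)) := rfl
  rw [this, heq]
  exact hS

/-- Left translations are isometric, so averaging them against `φ - χ` costs at most `‖φ - χ‖`. This
makes `φ ↦ (φ * ·)` continuous into the operator norm. -/
theorem norm_convCLM_toM_sub_le (φ χ : L1 m) :
    ‖convCLM m (memM_toM m φ) - convCLM m (memM_toM m χ)‖ ≤ ‖φ - χ‖ := by
  refine ContinuousLinearMap.opNorm_le_bound _ (norm_nonneg _) fun ψ => ?_
  have hm := aestronglyMeasurable_of_compactSpace m (continuous_leftTranslate m ψ)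
  have hb : ∀ x, ‖leftTranslate m x ψ‖ ≤ ‖ψ‖ := fun x => (norm_leftTranslate m x ψ).le
  have h : ∀ φ, convCLM m (memM_toM m φ) ψ = integralSMul hm hb φ := fun φ => conv_toM m φ ψ
  rw [sub_apply, h, h, ← map_sub, mul_comm]
  exact norm_integral_smul_le hb _

/-- Convolution by an `L¹` function on a compact group is a compact operator. -/
theorem isCompactOperator_conv_toM (φ : L1 m) : IsCompactOperator (conv m (toM m φ)) := by
  let M : L1 m → L1 m →L[ℂ] L1 m := fun φ => convCLM m (memM_toM m φ)
  have hM : Continuous M := (LipschitzWith.of_dist_le_mul (K := 1) fun φ χ => by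
    rw [dist_eq_norm, dist_eq_norm, NNReal.coe_one, one_mul]
    exact norm_convCLM_toM_sub_le m φ χ).continuous
  change IsCompactOperator (M φ)
  exact (ContinuousMap.toLp_denseRange ℂ m ℂ
    ENNReal.one_ne_top).induction_on φ
    (isClosed_setOfPred_isCompactOperator.preimage hM) fun φ => isCompactOperator_conv_toLp m φ

end Compact

/-! ### Regular complex measures are determined by test functions. -/

section Uniqueness

theorem integrable_of_bounded {X : Type*} [MeasurableSpace X] {μ : ComplexMeasure X} {f : X → ℂ}
    (hf : AEStronglyMeasurable f μ.variation) {C : ℝ} (hC : ∀ x, ‖f x‖ ≤ C) : μ.Integrable f := by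
  have := isFiniteMeasure_variation μ
  exact Integrable.of_bound hf C (ae_of_all _ hC)

variable {G : Type*} [TopologicalSpace G] [T2Space G] [MeasurableSpace G] [BorelSpace G]

/-- The indicator of `A` and `f` agree on `K` and off `A ∪ U`; elsewhere they differ by at most the
sum of the indicators of `A \ K` and `U \ K`. -/
theorem norm_sub_le_of_compact_of_open {μ : ComplexMeasure G} {A K U : Set G}
    (hA : MeasurableSet A) (hK : IsCompact K) (hU : IsOpen U) (hKA : K ⊆ A) {f : C(G, ℝ)}
    (hf1 : EqOn f 1 K) (hf0 : EqOn f 0 Uᶜ) (hf : ∀ x, f x ∈ Icc (0 : ℝ) 1) :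
    ‖μ A - μ.integral (fun x => (f x : ℂ)) (smulPairing ℂ)‖ ≤
      μ.variation.real (A \ K) + μ.variation.real (U \ K) := by
  have := isFiniteMeasure_variation μ
  have hfn : ∀ x, ‖(f x : ℂ)‖ ≤ 1 := fun x => by
    rw [Complex.norm_real, Real.norm_eq_abs, abs_of_nonneg (hf x).1]
    exact (hf x).2
  have hint1 : μ.Integrable fun x => (f x : ℂ) :=
    Integrable.of_bound (Complex.measurable_ofReal.comp
      f.continuous.measurable).aestronglyMeasurable 1 (ae_of_all _ hfn)
  have hint2 : μ.Integrable (A.indicator fun _ => (1 : ℂ)) :=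
    (integrable_const (1 : ℂ)).indicator hA
  have h1 : μ.integral (A.indicator fun _ => (1 : ℂ)) (smulPairing ℂ) = μ A := by
    rw [VectorMeasure.integral_indicator_const _ hA, smulPairing_apply, smul_eq_mul, mul_one]
  rw [← h1, ← VectorMeasure.integral_fun_sub hint2 hint1]
  refine (norm_integral_smulPairing_le _).trans ?_
  have hAK : MeasurableSet (A \ K) := hA.diff hK.measurableSet
  have hUK : MeasurableSet (U \ K) := hU.measurableSet.diff hK.measurableSet
  rw [← integral_indicator_one hAK, ← integral_indicator_one hUK,
    ← integral_add ((integrable_const _).indicator hAK) ((integrable_const _).indicator hUK)]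
  refine integral_mono (hint2.sub hint1).norm
    (((integrable_const _).indicator hAK).add ((integrable_const _).indicator hUK)) fun x => ?_
  have hx := hf x
  by_cases hxK : x ∈ K
  · simp [hxK, hKA hxK, hf1 hxK]
  · by_cases hxA : x ∈ A
    · have : ‖(1 : ℂ) - f x‖ ≤ 1 := by
        rw [← Complex.ofReal_one, ← Complex.ofReal_sub, Complex.norm_real, Real.norm_eq_abs,
          abs_of_nonneg (by linarith [hx.2])]
        linarith [hx.1]
      have h2 : 0 ≤ (U \ K).indicator (1 : G → ℝ) x := indicator_nonneg (by simp) x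
      have h3 : (A \ K).indicator (1 : G → ℝ) x = 1 := by simp [hxA, hxK]
      simp only [hxA, indicator_of_mem, h3]
      linarith
    · by_cases hxU : x ∈ U
      · simpa [hxA, hxK, hxU] using hfn x
      · have : f x = 0 := hf0 hxU
        simp [hxA, hxU, this]

/-- Regular complex measures are determined by the integrals of compactly supported continuous
functions. -/
theorem eq_of_forall_integral_eq [LocallyCompactSpace G] {μ ν : ComplexMeasure G} (hμ : μ.variation.Regular)
    (hν : ν.variation.Regular)
    (h : ∀ f : G → ℂ, Continuous f → HasCompactSupport f →
      μ.integral f (smulPairing ℂ) = ν.integral f (smulPairing ℂ)) : μ = ν := by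
  have := isFiniteMeasure_variation μ
  have := isFiniteMeasure_variation ν
  have : Measure.InnerRegular (μ.variation + ν.variation) := inferInstance
  have : (μ.variation + ν.variation).Regular := inferInstance
  ext A hA
  refine eq_of_forall_dist_le fun ε hε => ?_
  -- Regularity of the sum of the two variations gives one pair `K`, `U` serving both measures; the
  -- errors on `A \ K` and `U \ K` then add up to at most `ε / 2`.
  have hε4 : ENNReal.ofReal (ε / 4) ≠ 0 := by simpa using hε
  obtain ⟨K, hKA, hK, hK'⟩ := hA.exists_isCompact_sdiff_lt
    (μ := μ.variation + ν.variation) (measure_ne_top _ _) hε4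
  obtain ⟨U, hKU, hU, -, hU'⟩ := hK.measurableSet.exists_isOpen_sdiff_lt
    (μ := μ.variation + ν.variation) (measure_ne_top _ _) hε4
  obtain ⟨f, hf1, hf0, hfs, hf⟩ := exists_continuous_one_zero_of_isCompact hK hU.isClosed_compl
    (disjoint_compl_right_iff_subset.2 hKU)
  have h1 := norm_sub_le_of_compact_of_open (μ := μ) hA hK hU hKA hf1 hf0 hf
  have h2 := norm_sub_le_of_compact_of_open (μ := ν) hA hK hU hKA hf1 hf0 hf
  have h3 := h (fun x => (f x : ℂ)) (by fun_prop) (hfs.comp_left Complex.ofReal_zero)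
  have h4 : ∀ S, (μ.variation + ν.variation) S < ENNReal.ofReal (ε / 4) →
      μ.variation.real S + ν.variation.real S ≤ ε / 4 := by
    intro S hS
    rw [Measure.add_apply] at hS
    have := ENNReal.toReal_le_of_le_ofReal (by positivity) hS.le
    rwa [ENNReal.toReal_add (measure_ne_top _ _) (measure_ne_top _ _)] at this
  have h5 := h4 _ hK'
  have h6 := h4 _ hU'
  rw [h3] at h1
  have h7 := norm_sub_le_norm_sub_add_norm_sub (μ A)
    (ν.integral (fun x => (f x : ℂ)) (smulPairing ℂ)) (ν A)
  rw [norm_sub_rev (ν.integral _ _) (ν A)] at h7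
  rw [dist_eq_norm]
  linarith

end Uniqueness

/-! ### An approximate identity of `L¹(G)`. -/

section ApproximateIdentity

variable {G : Type*} [Group G] [TopologicalSpace G]

theorem eventually_norm_mul_sub_le [IsTopologicalGroup G] {f : G → ℂ} (hf : Continuous f) (hfs : HasCompactSupport f)
    {ε : ℝ} (hε : 0 < ε) : ∀ᶠ y in 𝓝 (1 : G), ∀ x, ‖f (x * y) - f x‖ ≤ ε := by
  -- In the left uniformity `x` and `x * y` are close when `y` is near `1`, uniformly in `x`.
  let _ : UniformSpace G := IsTopologicalGroup.leftUniformSpace G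
  have h := hfs.uniformContinuous_of_continuous hf
  have h2 := h (Metric.dist_mem_uniformity hε)
  rw [mem_map] at h2
  obtain ⟨V, hV, hV'⟩ := h2
  filter_upwards [hV] with y hy x
  have h3 : (x, x * y) ∈ (fun p : G × G => p.1⁻¹ * p.2) ⁻¹' V := by simpa using hy
  have h4 : dist (f x) (f (x * y)) < ε := hV' h3
  rw [dist_comm, dist_eq_norm] at h4
  exact h4.le

variable [LocallyCompactSpace G] [T2Space G] [MeasurableSpace G] [BorelSpace G]
  (m : Measure G) [m.IsHaarMeasure]

/-- The witness is the normalized indicator of a compact neighbourhood of `1` inside `V`, so the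
integral is an average of `k` over part of `V`. -/
theorem exists_norm_integral_sub_le {V : Set G} (hV : V ∈ 𝓝 (1 : G)) :
    ∃ φ : L1 m, ‖φ‖ ≤ 1 ∧ ∀ (k : G → ℂ), Continuous k → ∀ (c : ℂ) (ε : ℝ),
      (∀ y ∈ V, ‖k y - c‖ ≤ ε) → ‖∫ y, φ y • k y ∂m - c‖ ≤ ε := by
  obtain ⟨K, hKn, hKV, hK⟩ := local_compact_nhds hV
  have hm0 : m K ≠ 0 := (Measure.measure_pos_of_mem_nhds m hKn).ne'
  have hmt : m K ≠ ⊤ := hK.measure_lt_top.ne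
  have hr : 0 < m.real K := ENNReal.toReal_pos hm0 hmt
  refine ⟨((m.real K)⁻¹ : ℂ) • indicatorConstLp 1 hK.measurableSet hmt (1 : ℂ), ?_, ?_⟩
  · rw [norm_smul, norm_indicatorConstLp one_ne_zero ENNReal.one_ne_top]
    simp [abs_of_pos hr, hr.ne']
  · intro k hk c ε hkε
    have h1 : ∫ y, (((m.real K)⁻¹ : ℂ) • indicatorConstLp 1 hK.measurableSet hmt (1 : ℂ) : L1 m) y
        • k y ∂m = ((m.real K)⁻¹ : ℂ) * ∫ y in K, k y ∂m := by
      rw [← integral_const_mul, ← integral_indicator hK.measurableSet]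
      refine integral_congr_ae ?_
      filter_upwards [Lp.coeFn_smul ((m.real K)⁻¹ : ℂ)
        (indicatorConstLp 1 hK.measurableSet hmt (1 : ℂ)),
        indicatorConstLp_coeFn (p := 1) (hs := hK.measurableSet) (hμs := hmt) (c := (1 : ℂ))]
        with y h1 h2
      rw [h1, Pi.smul_apply, h2]
      by_cases hy : y ∈ K <;> simp [hy]
    have hki : IntegrableOn k K m := hk.continuousOn.integrableOn_compact hK
    have h2 : ∫ y in K, (k y - c) ∂m = ∫ y in K, k y ∂m - m.real K * c := by
      rw [integral_sub hki (integrableOn_const hmt), setIntegral_const]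
      simp
    have h3 : ((m.real K)⁻¹ : ℂ) * ∫ y in K, k y ∂m - c =
        ((m.real K)⁻¹ : ℂ) * ∫ y in K, (k y - c) ∂m := by
      rw [h2, mul_sub, inv_mul_cancel_left₀]
      exact_mod_cast hr.ne'
    rw [h1, h3, norm_mul]
    have h4 := norm_setIntegral_le_of_norm_le_const (μ := m) hK.measure_lt_top
      fun y hy => hkε y (hKV hy)
    calc _ ≤ ‖((m.real K)⁻¹ : ℂ)‖ * (ε * m.real K) := by gcongr
      _ = ε := by
        rw [norm_inv, Complex.norm_real, Real.norm_eq_abs, abs_of_pos hr]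
        field_simp

variable [IsTopologicalGroup G] [m.Regular]

theorem integral_conv_smul {μ : ComplexMeasure G} (hμ : MemM μ) (φ : L1 m) {f : G → ℂ}
    (hf : Continuous f) {C : ℝ} (hC : ∀ x, ‖f x‖ ≤ C) :
    (∫ z, conv m μ φ z • f z ∂m) =
        μ.integral (fun x => ∫ y, φ y • f (x * y) ∂m) (smulPairing ℂ) ∧
      μ.Integrable (fun x => ∫ y, φ y • f (x * y) ∂m) := by
  have hfm : AEStronglyMeasurable f m := hf.measurable.aestronglyMeasurable
  have h := clm_apply_integral (integralSMul hfm hC) (integrable_leftTranslate m hμ φ)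
  have h1 : ∀ x, integralSMul hfm hC (leftTranslate m x φ) = ∫ y, φ y • f (x * y) ∂m := by
    intro x
    rw [integralSMul_apply, ← integral_mul_left_eq_self (fun z => leftTranslate m x φ z • f z) x]
    refine integral_congr_ae ?_
    filter_upwards [(measurePreserving_mul_left m x).quasiMeasurePreserving.ae
      (coeFn_leftTranslate m x φ)] with y hy
    rw [hy, inv_mul_cancel_left]
  have h2 := (integralSMul hfm hC).integrable_comp (integrable_leftTranslate m hμ φ)
  simp only [h1] at h h2
  exact ⟨h, h2⟩

/-- An approximate identity: convolving with it converges to `μ` against compactly supported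
continuous functions. -/
theorem exists_approximate_identity :
    ∃ l : Filter (L1 m), l.NeBot ∧ (∀ᶠ φ in l, ‖φ‖ ≤ 1) ∧
      ∀ μ : ComplexMeasure G, MemM μ → ∀ f : G → ℂ, Continuous f → HasCompactSupport f →
        Tendsto (fun φ : L1 m => ∫ z, conv m μ φ z • f z ∂m) l
          (𝓝 (μ.integral f (smulPairing ℂ))) := by
  choose! Φ hΦ1 hΦ2 using fun V (hV : V ∈ 𝓝 (1 : G)) => exists_norm_integral_sub_le m hV
  -- `smallSets` alone also admits sets that are not neighbourhoods of `1`, for which `Φ` carries no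
  -- information; hence the restriction.
  have hne : ((𝓝 (1 : G)).smallSets ⊓ 𝓟 {V | V ∈ 𝓝 (1 : G)}).NeBot := by
    rw [inf_principal_neBot_iff]
    intro s hs
    obtain ⟨V, hV, hVs⟩ := (𝓝 (1 : G)).basis_sets.smallSets.mem_iff.1 hs
    exact ⟨V, hVs (mem_powerset subset_rfl), hV⟩
  have hmem : ∀ᶠ V in (𝓝 (1 : G)).smallSets ⊓ 𝓟 {V | V ∈ 𝓝 (1 : G)}, V ∈ 𝓝 (1 : G) :=
    mem_inf_of_right (mem_principal_self _)
  refine ⟨map Φ ((𝓝 (1 : G)).smallSets ⊓ 𝓟 {V | V ∈ 𝓝 (1 : G)}), hne.map _, ?_, ?_⟩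
  · exact hmem.mono fun V hV => hΦ1 V hV
  · intro μ hμ f hf hfs
    have := isFiniteMeasure_variation μ
    obtain ⟨C, hC⟩ := hfs.exists_bound_of_continuous hf
    rw [tendsto_map'_iff, Metric.tendsto_nhds]
    intro ε hε
    have hM : 0 < μ.variation.real univ + 1 := by positivity
    -- The `+ 1` keeps the denominator positive when `μ = 0`.
    have hδ : 0 < ε / (2 * (μ.variation.real univ + 1)) := by positivity
    have hsmall : ∀ᶠ V in (𝓝 (1 : G)).smallSets ⊓ 𝓟 {V | V ∈ 𝓝 (1 : G)},
        ∀ y ∈ V, ∀ x, ‖f (x * y) - f x‖ ≤ ε / (2 * (μ.variation.real univ + 1)) :=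
      mem_inf_of_left (eventually_smallSets_forall.2 (eventually_norm_mul_sub_le hf hfs hδ))
    filter_upwards [hmem, hsmall] with V hV hVs
    obtain ⟨h1, h2⟩ := integral_conv_smul m hμ (Φ V) hf hC
    have hfm : AEStronglyMeasurable f μ.variation := hf.measurable.aestronglyMeasurable
    rw [Function.comp_apply, h1, dist_eq_norm,
      ← VectorMeasure.integral_fun_sub h2 (integrable_of_bounded hfm hC)]
    refine (norm_integral_smulPairing_le _).trans_lt ?_
    have h3 : ∀ x, ‖∫ y, Φ V y • f (x * y) ∂m - f x‖ ≤
        ε / (2 * (μ.variation.real univ + 1)) := fun x =>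
      hΦ2 V hV (fun y => f (x * y)) (by fun_prop) (f x) _ fun y hy => hVs y hy x
    calc _ ≤ ∫ x, ε / (2 * (μ.variation.real univ + 1)) ∂μ.variation :=
          integral_mono_of_nonneg (ae_of_all _ fun x => norm_nonneg _) (integrable_const _)
            (ae_of_all _ h3)
      _ = μ.variation.real univ * (ε / (2 * (μ.variation.real univ + 1))) := by simp
      _ < ε := by
        rw [mul_div_assoc', div_lt_iff₀ (by positivity)]
        nlinarith [measureReal_nonneg (μ := μ.variation) (s := univ)]

end ApproximateIdentity

/-! ### Consequences of weak compactness: weak limits and the density of `μ`. -/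

section WeaklyCompact

/-- A linear compact operator is weakly compact. -/
theorem isWeaklyCompactOperator_of_isCompactOperator {E F : Type*} [NormedAddCommGroup E]
    [NormedSpace ℂ E] [NormedAddCommGroup F] [NormedSpace ℂ F] {T : E →ₗ[ℂ] F}
    (hT : IsCompactOperator T) : IsWeaklyCompactOperator T := by
  obtain ⟨K, hK, hKT⟩ := hT.image_closedBall_subset_compact 1
  have hK' : IsCompact (toWeakSpaceCLM ℂ F '' K) := hK.image (toWeakSpaceCLM ℂ F).continuous
  have hT2 : T2Space (WeakSpace ℂ F) := inferInstance
  refine hK'.of_isClosed_subset isClosed_closure (closure_minimal ?_ hK'.isClosed)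
  rintro _ ⟨v, hv, rfl⟩
  exact ⟨T v, hKT ⟨v, hv, rfl⟩, rfl⟩

variable {G : Type*} [Group G] [TopologicalSpace G] [IsTopologicalGroup G]
  [LocallyCompactSpace G] [T2Space G] [MeasurableSpace G] [BorelSpace G]
  (m : Measure G) [m.IsHaarMeasure] [m.Regular]

/-- If `Λ_{μ, α}` is weakly compact for a surjective `α`, then `μ * φ` has weak limits along
bounded filters. -/
theorem exists_ultrafilter_tendsto {μ : ComplexMeasure G} (hμ : MemM μ) {α : L1 m →ₗ[ℂ] L1 m}
    (hαc : Continuous α) (hαs : Function.Surjective α)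
    (hΛ : IsWeaklyCompactOperator (Lam m μ α)) {ι : Type*} (l : Filter ι) [l.NeBot] {C : ℝ}
    (φ : ι → L1 m) (hl : ∀ᶠ i in l, ‖φ i‖ ≤ C) :
    ∃ u : Ultrafilter ι, (u : Filter ι) ≤ l ∧ ∃ h : L1 m, ∀ ℓ : L1 m →L[ℂ] ℂ,
      Tendsto (fun i => ℓ (conv m μ (φ i))) u (𝓝 (ℓ h)) := by
  -- Open mapping theorem: preimages under `α` can be chosen with norm at most `D * ‖φ‖`.
  obtain ⟨D, hD, hα⟩ := (⟨α, hαc⟩ : L1 m →L[ℂ] L1 m).exists_preimage_norm_le hαs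
  choose β hβ1 hβ2 using hα
  -- Dividing by `R` brings the preimages into the unit ball; `|C|` and `+ 1` ensure `R > 0`
  -- whatever the sign of `C`.
  set R : ℝ := D * |C| + 1 with hR
  have hR0 : 0 < R := by positivity
  let W : ι → WeakSpace ℂ (L1 m) := fun i =>
    toWeakSpace ℂ (L1 m) (Lam m μ α (((R : ℂ)⁻¹) • β (φ i)))
  have hW : ∀ i, conv m μ (φ i) = (R : ℂ) • (Lam m μ α (((R : ℂ)⁻¹) • β (φ i))) := by
    intro i
    have h1 : α (β (φ i)) = φ i := hβ1 (φ i)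
    have h2 : (R : ℂ) ≠ 0 := by exact_mod_cast hR0.ne'
    change _ = (R : ℂ) • convCLM m hμ (α (((R : ℂ)⁻¹) • β (φ i)))
    rw [map_smul, h1, map_smul, smul_inv_smul₀ h2, convCLM_apply]
  have hu : map W (Ultrafilter.of l : Filter ι) ≤ 𝓟 (closure
      ((fun v => toWeakSpace ℂ (L1 m) (Lam m μ α v)) '' Metric.closedBall (0 : L1 m) 1)) := by
    rw [le_principal_iff, mem_map]
    filter_upwards [Ultrafilter.of_le l hl] with i hi
    refine subset_closure ⟨((R : ℂ)⁻¹) • β (φ i), ?_, rfl⟩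
    rw [mem_closedBall_zero_iff, norm_smul, norm_inv, Complex.norm_real, Real.norm_eq_abs,
      abs_of_pos hR0, inv_mul_le_iff₀ hR0, mul_one]
    refine (hβ2 (φ i)).trans ?_
    have : D * ‖φ i‖ ≤ D * |C| := by
      gcongr
      exact hi.trans (le_abs_self C)
    linarith
  obtain ⟨h, -, hh⟩ := isCompact_iff_ultrafilter_le_nhds.1 hΛ ((Ultrafilter.of l).map W) hu
  refine ⟨Ultrafilter.of l, Ultrafilter.of_le l, (R : ℂ) • (toWeakSpace ℂ (L1 m)).symm h,
    fun ℓ => ?_⟩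
  have hc : Continuous fun x : WeakSpace ℂ (L1 m) => ℓ ((toWeakSpace ℂ (L1 m)).symm x) :=
    WeakBilin.eval_continuous _ ℓ
  have h3 : Tendsto W (Ultrafilter.of l) (𝓝 h) := hh
  have h4 := ((hc.tendsto h).comp h3).const_mul (R : ℂ)
  rw [map_smul, smul_eq_mul]
  refine h4.congr fun i => ?_
  rw [hW i, map_smul, smul_eq_mul]
  rfl

/-- If `μ * φ` has a weak limit `h` along an approximate identity, then `μ = h dm`. -/
theorem exists_toM_eq {μ : ComplexMeasure G} (hμ : MemM μ)
    (hlim : ∀ (l : Filter (L1 m)) [l.NeBot], (∀ᶠ φ in l, ‖φ‖ ≤ 1) →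
      ∃ u : Ultrafilter (L1 m), (u : Filter (L1 m)) ≤ l ∧ ∃ h : L1 m, ∀ ℓ : L1 m →L[ℂ] ℂ,
      Tendsto (fun φ => ℓ (conv m μ φ)) u (𝓝 (ℓ h))) : ∃ h : L1 m, toM m h = μ := by
  obtain ⟨l, hl, hl1, hlt⟩ := exists_approximate_identity m
  obtain ⟨u, hu, h, hh⟩ := hlim l hl1
  refine ⟨h, eq_of_forall_integral_eq (memM_toM m h) hμ fun f hf hfs => ?_⟩
  obtain ⟨C, hC⟩ := hfs.exists_bound_of_continuous hf
  have hint : (toM m h).Integrable f := integrable_of_bounded hf.measurable.aestronglyMeasurable hC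
  have h1 : (toM m h).integral f (smulPairing ℂ) = ∫ z, h z • f z ∂m :=
    integral_withDensityᵥ m (L1.integrable_coeFn h) (Lp.stronglyMeasurable h) hint
  rw [h1]
  -- Both sides are limits of `∫ (μ * φ) f dm` along `u`: one by weak convergence against the
  -- bounded function `f`, the other by the approximate identity.
  exact tendsto_nhds_unique
    (hh (integralSMul (m := m) hf.measurable.aestronglyMeasurable hC))
    ((hlt μ hμ f hf hfs).mono_left hu)

/-- If `μ * φ` always vanished, the approximate identity would give `∫ f dμ = 0` for every test
function `f`. -/
theorem exists_conv_ne_zero {μ : ComplexMeasure G} (hμ : MemM μ) (hμ0 : μ ≠ 0) :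
    ∃ φ : L1 m, conv m μ φ ≠ 0 := by
  by_contra! hcon
  refine hμ0 (eq_of_forall_integral_eq hμ ?_ fun f hf hfs => ?_)
  · rw [VectorMeasure.variation_zero]
    infer_instance
  obtain ⟨l, hl, -, hlt⟩ := exists_approximate_identity m
  rw [VectorMeasure.integral_zero_vectorMeasure]
  refine tendsto_nhds_unique (hlt μ hμ f hf hfs) (tendsto_const_nhds.congr fun φ => ?_)
  rw [hcon φ]
  simp

end WeaklyCompact

/-! ### Right translation on a possibly non-unimodular group. -/

section RightTranslation

variable {G : Type*} [Group G] [TopologicalSpace G] [IsTopologicalGroup G]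
  [LocallyCompactSpace G] [MeasurableSpace G] [BorelSpace G]
  (m : Measure G) [m.IsHaarMeasure] [m.Regular]

theorem exists_map_mul_right_eq_smul (y : G) :
    ∃ c : ℝ≥0, c ≠ 0 ∧ m.map (· * y) = c • m := by
  have : (m.map (· * y)).Regular := Measure.Regular.map (Homeomorph.mulRight y)
  exact ⟨_, (Measure.haarScalarFactor_pos_of_isHaarMeasure (m.map (· * y)) m).ne',
    Measure.isMulLeftInvariant_eq_smul_of_regular (m.map (· * y)) m⟩

/-- The factor `c` by which right translation scales Haar measure: `m (A y⁻¹) = c * m A`. -/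
noncomputable def rightFactor (y : G) : ℝ≥0 := (exists_map_mul_right_eq_smul m y).choose

theorem rightFactor_ne_zero (y : G) : rightFactor m y ≠ 0 :=
  (exists_map_mul_right_eq_smul m y).choose_spec.1

theorem map_mul_right_eq_smul (y : G) : m.map (· * y) = rightFactor m y • m :=
  (exists_map_mul_right_eq_smul m y).choose_spec.2

theorem quasiMeasurePreserving_mul_right (y : G) :
    Measure.QuasiMeasurePreserving (· * y) m m :=
  ⟨measurable_mul_const y, by
    rw [map_mul_right_eq_smul]
    exact Measure.smul_absolutelyContinuous⟩

theorem integrable_comp_mul_right {E : Type*} [NormedAddCommGroup E] (y : G) {f : G → E}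
    (hf : Integrable f m) : Integrable (fun x => f (x * y)) m := by
  have h : Integrable f (m.map (· * y)) := by
    rw [map_mul_right_eq_smul]
    exact hf.smul_measure_nnreal
  exact h.comp_measurable (measurable_mul_const y)

theorem setIntegral_comp_mul_right {E : Type*} [NormedAddCommGroup E] [NormedSpace ℝ E] (y : G)
    (f : G → E) (A : Set G) :
    ∫ x in (· * y) ⁻¹' A, f (x * y) ∂m = rightFactor m y • ∫ x in A, f x ∂m := by
  rw [← integral_smul_nnreal_measure, ← Measure.restrict_smul, ← map_mul_right_eq_smul]
  exact ((Homeomorph.mulRight y).measurableEmbedding.setIntegral_map f A).symm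

/-- Right translation on `L¹(G)`, normalized to be isometric. -/
noncomputable def rightTranslate (y : G) : L1 m →L[ℂ] L1 m :=
  LinearMap.mkContinuous
    { toFun := fun φ => ((rightFactor m y : ℂ))⁻¹ •
        (integrable_comp_mul_right m y (L1.integrable_coeFn φ)).toL1 _
      map_add' := fun φ ψ => by
        rw [← smul_add, ← Integrable.toL1_add]
        congr 1
        rw [Integrable.toL1_eq_toL1_iff]
        exact (quasiMeasurePreserving_mul_right m y).ae (Lp.coeFn_add φ ψ)
      map_smul' := fun c φ => by
        rw [RingHom.id_apply, smul_comm]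
        refine congrArg (fun v => ((rightFactor m y : ℂ))⁻¹ • v)
          (Eq.trans ?_ (Integrable.toL1_smul _ _ c))
        rw [Integrable.toL1_eq_toL1_iff]
        exact (quasiMeasurePreserving_mul_right m y).ae (Lp.coeFn_smul c φ) } 1 fun φ => by
    change ‖((rightFactor m y : ℂ))⁻¹ •
        (integrable_comp_mul_right m y (L1.integrable_coeFn φ)).toL1 _‖ ≤ 1 * ‖φ‖
    have h := setIntegral_comp_mul_right m y (fun x => ‖φ x‖) univ
    rw [preimage_univ, setIntegral_univ, setIntegral_univ] at h
    rw [norm_smul, L1.norm_of_fun_eq_integral_norm, h, L1.norm_eq_integral_norm, one_mul,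
      NNReal.smul_def, smul_eq_mul, norm_inv, Complex.norm_real, Real.norm_eq_abs, NNReal.abs_eq,
      inv_mul_cancel_left₀ (by exact_mod_cast rightFactor_ne_zero m y)]

theorem coeFn_rightTranslate (y : G) (φ : L1 m) :
    rightTranslate m y φ =ᵐ[m] fun x => ((rightFactor m y : ℂ))⁻¹ * φ (x * y) := by
  have h1 : rightTranslate m y φ = ((rightFactor m y : ℂ))⁻¹ •
        (integrable_comp_mul_right m y (L1.integrable_coeFn φ)).toL1 _ := rfl
  rw [h1]
  filter_upwards [Lp.coeFn_smul ((rightFactor m y : ℂ))⁻¹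
    ((integrable_comp_mul_right m y (L1.integrable_coeFn φ)).toL1 _),
    (integrable_comp_mul_right m y (L1.integrable_coeFn φ)).coeFn_toL1] with x h2 h3
  rw [h2, Pi.smul_apply, h3, smul_eq_mul]

theorem norm_rightTranslate_le (y : G) (φ : L1 m) : ‖rightTranslate m y φ‖ ≤ ‖φ‖ :=
  ((rightTranslate m y).le_of_opNorm_le (LinearMap.mkContinuous_norm_le _ zero_le_one _) φ).trans
    (one_mul _).le

theorem setIntegral_rightTranslate (y : G) (φ : L1 m) (A : Set G) :
    ∫ x in (· * y) ⁻¹' A, rightTranslate m y φ x ∂m = ∫ x in A, φ x ∂m := by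
  rw [integral_congr_ae (ae_restrict_of_ae (coeFn_rightTranslate m y φ)), integral_const_mul,
    setIntegral_comp_mul_right m y (fun x => φ x) A, NNReal.smul_def, ← Complex.coe_smul,
    smul_eq_mul, inv_mul_cancel_left₀]
  exact_mod_cast rightFactor_ne_zero m y

theorem setIntegral_norm_rightTranslate (y : G) (φ : L1 m) (A : Set G) :
    ∫ x in (· * y) ⁻¹' A, ‖rightTranslate m y φ x‖ ∂m = ∫ x in A, ‖φ x‖ ∂m := by
  have h : ∀ᵐ x ∂m, ‖rightTranslate m y φ x‖ = ((rightFactor m y : ℝ))⁻¹ * ‖φ (x * y)‖ := by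
    filter_upwards [coeFn_rightTranslate m y φ] with x hx
    rw [hx, norm_mul, norm_inv, Complex.norm_real, Real.norm_eq_abs, NNReal.abs_eq]
  rw [integral_congr_ae (ae_restrict_of_ae h), integral_const_mul,
    setIntegral_comp_mul_right m y (fun x => ‖φ x‖) A, NNReal.smul_def,
    smul_eq_mul, inv_mul_cancel_left₀]
  exact_mod_cast rightFactor_ne_zero m y

theorem rightTranslate_leftTranslate (x y : G) (φ : L1 m) :
    rightTranslate m y (leftTranslate m x φ) = leftTranslate m x (rightTranslate m y φ) := by
  apply Lp.ext
  filter_upwards [coeFn_rightTranslate m y (leftTranslate m x φ),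
    (quasiMeasurePreserving_mul_right m y).ae (coeFn_leftTranslate m x φ),
    coeFn_leftTranslate m x (rightTranslate m y φ),
    (measurePreserving_mul_left m x⁻¹).quasiMeasurePreserving.ae (coeFn_rightTranslate m y φ)]
    with z h1 h2 h3 h4
  rw [h1, h2, h3, h4, mul_assoc]

/-- Right translation is bounded and commutes with left translations, so it passes through the
integral defining `μ * φ`. -/
theorem conv_rightTranslate [T2Space G] {μ : ComplexMeasure G} (hμ : MemM μ) (y : G) (φ : L1 m) :
    conv m μ (rightTranslate m y φ) = rightTranslate m y (conv m μ φ) := by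
  refine Eq.trans ?_ (clm_apply_integral (rightTranslate m y)
    (integrable_leftTranslate m hμ φ)).symm
  simp only [rightTranslate_leftTranslate]
  rfl

end RightTranslation

/-! ### Right translates on a noncompact group have no weak limit. -/

section Noncompact

/-- The functional `φ ↦ ∫_B φ dm` on `L¹`. -/
theorem exists_clm_setIntegral {X : Type*} [MeasurableSpace X] (m : Measure X) {B : Set X} 
    (hB : MeasurableSet B) : ∃ ℓ : Lp ℂ 1 m →L[ℂ] ℂ, ∀ φ : Lp ℂ 1 m, ℓ φ = ∫ x in B, φ x ∂m := by
  have h1 : AEStronglyMeasurable (B.indicator fun _ => (1 : ℂ)) m :=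
    (measurable_const.indicator hB).aestronglyMeasurable
  have h2 : ∀ x, ‖B.indicator (fun _ => (1 : ℂ)) x‖ ≤ 1 := fun x => by
    by_cases hx : x ∈ B <;> simp [hx]
  refine ⟨integralSMul h1 h2, fun φ => ?_⟩
  rw [integralSMul_apply, ← integral_indicator hB]
  congr 1
  ext x
  by_cases hx : x ∈ B <;> simp [hx]

variable {G : Type*} [Group G] [TopologicalSpace G] [IsTopologicalGroup G]

theorem exists_seq_disjoint_preimage_mul_right [NoncompactSpace G] {K : Set G}
    (hK : IsCompact K) :
    ∃ y : ℕ → G, Pairwise fun i j => Disjoint ((· * y i) ⁻¹' K) ((· * y j) ⁻¹' K) := by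
  obtain ⟨y, -, hy⟩ := exists_seq_of_forall_finset_exists (fun _ : G => True)
    (fun x y => Disjoint ((· * x) ⁻¹' K) ((· * y) ⁻¹' K)) fun s _ => by
      -- If `z * x` and `z * y` both lie in `K`, then `y ∈ x * K⁻¹ * K`. A new `y` outside this
      -- compact set, which is not all of `G`, therefore avoids every earlier translate.
      have hc : IsCompact ((s : Set G) * K⁻¹ * K) := (s.finite_toSet.isCompact.mul hK.inv).mul hK
      obtain ⟨y, hy⟩ := (ne_univ_iff_exists_notMem _).1 hc.ne_univ
      refine ⟨y, trivial, fun x hx => disjoint_left.2 fun z hz hz' => hy ?_⟩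
      have : y = x * (z * x)⁻¹ * (z * y) := by group
      rw [this]
      exact mul_mem_mul (mul_mem_mul hx (inv_mem_inv.2 hz)) hz'
  refine ⟨y, fun i j hij => ?_⟩
  rcases hij.lt_or_gt with h | h
  · exact hy i j h
  · exact (hy j i h).symm

variable [LocallyCompactSpace G] [T2Space G] [MeasurableSpace G] [BorelSpace G]
  (m : Measure G) [m.IsHaarMeasure] [m.Regular]

/-- The measure `|φ| dm` is finite and regular, being the variation of `φ dm`, so a compact set
carries all but `ε` of it. -/
theorem exists_isCompact_setIntegral_norm_lt (φ : L1 m) {ε : ℝ} (hε : 0 < ε) :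
    ∃ K : Set G, IsCompact K ∧ ∫ x in Kᶜ, ‖φ x‖ ∂m < ε := by
  have := isFiniteMeasure_variation (toM m φ)
  have hreg : (toM m φ).variation.Regular := memM_toM m φ
  have hvar : (toM m φ).variation = m.withDensity fun x => ‖φ x‖ₑ :=
    Measure.variation_withDensityᵥ (L1.integrable_coeFn φ)
  obtain ⟨K, -, hK, hK'⟩ := MeasurableSet.univ.exists_isCompact_sdiff_lt
    (μ := (toM m φ).variation) (measure_ne_top _ _) (ε := ENNReal.ofReal ε) (by simpa using hε)
  refine ⟨K, hK, ?_⟩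
  rw [← compl_eq_univ_sdiff, hvar, withDensity_apply _ hK.measurableSet.compl] at hK'
  rw [integral_norm_eq_lintegral_enorm (Lp.aestronglyMeasurable φ).restrict]
  exact ENNReal.toReal_lt_of_lt_ofReal hK'

/-- On a noncompact group the right translates of a nonzero function have no weak limits along
suitable sequences. -/
theorem compactSpace_of_forall_exists_ultrafilter {F : L1 m} (hF : F ≠ 0)
    (h : ∀ y : ℕ → G, ∃ u : Ultrafilter ℕ, (u : Filter ℕ) ≤ atTop ∧ ∃ g : L1 m,
      ∀ ℓ : L1 m →L[ℂ] ℂ, Tendsto (fun n => ℓ (rightTranslate m (y n) F)) u (𝓝 (ℓ g))) :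
    CompactSpace G := by
  by_contra hG
  rw [not_compactSpace_iff] at hG
  have hFi : Integrable F m := L1.integrable_coeFn F
  obtain ⟨E, hE, hE0⟩ : ∃ E, MeasurableSet E ∧ ∫ x in E, F x ∂m ≠ 0 := by
    by_contra! hcon
    refine hF (Lp.ext ?_)
    refine (hFi.ae_eq_zero_of_forall_setIntegral_eq_zero fun s hs _ => hcon s hs).trans ?_
    exact (Lp.coeFn_zero ℂ 1 m).symm
  -- The tail `η` is paid twice, in passing from `E` to `A` and in discarding the other translates;
  -- half of `‖∫_E F‖` keeps `‖∫_A F‖ - η` positive.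
  have hε : 0 < ‖∫ x in E, F x ∂m‖ / 2 := by positivity
  obtain ⟨K, hK, hKε⟩ := exists_isCompact_setIntegral_norm_lt m F hε
  have hKm := hK.measurableSet
  set η := ∫ x in Kᶜ, ‖F x‖ ∂m with hη
  set A := E ∩ K with hA
  have hAm : MeasurableSet A := hE.inter hKm
  have hAη : ‖∫ x in E, F x ∂m‖ ≤ ‖∫ x in A, F x ∂m‖ + η := by
    rw [← integral_inter_add_sdiff hKm hFi.integrableOn]
    refine (norm_add_le _ _).trans (add_le_add_right ?_ _)
    refine (norm_integral_le_integral_norm _).trans ?_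
    exact setIntegral_mono_set hFi.norm.integrableOn (ae_of_all _ fun x => norm_nonneg _)
      (ae_of_all _ fun x hx => hx.2)
  obtain ⟨y, hy⟩ := exists_seq_disjoint_preimage_mul_right hK
  obtain ⟨u, hu, g, hg⟩ := h y
  -- A single set `B N` catches the main mass of every translate with `n ≥ N`, so the lower bound
  -- passes to the weak limit `g`.
  let B : ℕ → Set G := fun N => ⋃ n ∈ Ici N, (· * y n) ⁻¹' A
  have hBm : ∀ N, MeasurableSet (B N) := fun N =>
    MeasurableSet.biUnion (to_countable _) fun n _ => measurable_mul_const (y n) hAm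
  have hlow : ∀ N n, N ≤ n →
      ‖∫ x in A, F x ∂m‖ - η ≤ ‖∫ x in B N, rightTranslate m (y n) F x ∂m‖ := by
    intro N n hn
    have hint : Integrable (rightTranslate m (y n) F) m := L1.integrable_coeFn _
    have hsub : (· * y n) ⁻¹' A ⊆ B N := fun x hx => mem_biUnion (mem_Ici.2 hn) hx
    have h1 : ∫ x in B N, rightTranslate m (y n) F x ∂m = ∫ x in A, F x ∂m +
        ∫ x in B N \ (· * y n) ⁻¹' A, rightTranslate m (y n) F x ∂m := by
      rw [← setIntegral_rightTranslate m (y n) F A,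
        ← integral_inter_add_sdiff (measurable_mul_const (y n) hAm) hint.integrableOn,
        inter_eq_self_of_subset_right hsub]
    -- The rest of `B N` lies in other translates of `K`, disjoint from the `n`-th one, and so only
    -- meets the tail of the translated `F`.
    have h2 : ‖∫ x in B N \ (· * y n) ⁻¹' A, rightTranslate m (y n) F x ∂m‖ ≤ η := by
      rw [hη, ← setIntegral_norm_rightTranslate m (y n) F Kᶜ]
      refine (norm_integral_le_integral_norm _).trans ?_
      refine setIntegral_mono_set hint.norm.integrableOn (ae_of_all _ fun x => norm_nonneg _)
        (ae_of_all _ fun x hx => ?_)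
      obtain ⟨hxB, hxA⟩ := hx
      obtain ⟨k, -, hk⟩ := mem_iUnion₂.1 hxB
      have hkn : k ≠ n := fun e => hxA (e ▸ hk)
      exact fun hxK => disjoint_left.1 (hy hkn) hk.2 hxK
    rw [h1]
    have h3 := norm_sub_le_norm_add (∫ x in A, F x ∂m)
      (∫ x in B N \ (· * y n) ⁻¹' A, rightTranslate m (y n) F x ∂m)
    linarith
  have hlow' : ∀ N, ‖∫ x in A, F x ∂m‖ - η ≤ ‖∫ x in B N, g x ∂m‖ := by
    intro N
    obtain ⟨ℓ, hℓ⟩ := exists_clm_setIntegral m (hBm N)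
    rw [← hℓ g]
    refine ge_of_tendsto (hg ℓ).norm ?_
    filter_upwards [hu (eventually_ge_atTop N)] with n hn
    rw [hℓ]
    exact hlow N n hn
  have hanti : Antitone B := fun N M hNM =>
    biUnion_subset_biUnion_left (Ici_subset_Ici.2 hNM)
  -- By disjointness each point lies in at most one translate, hence leaves `B N` once `N` exceeds
  -- its index.
  have hinter : ⋂ N, B N = ∅ := by
    rw [eq_empty_iff_forall_notMem]
    intro x hx
    obtain ⟨k, -, hk⟩ := mem_iUnion₂.1 (mem_iInter.1 hx 0)
    obtain ⟨l, hl, hl'⟩ := mem_iUnion₂.1 (mem_iInter.1 hx (k + 1))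
    have hkl : k ≠ l := (Nat.lt_of_succ_le hl).ne
    exact disjoint_left.1 (hy hkl) hk.2 hl'.2
  have hlim := tendsto_setIntegral_of_antitone (μ := m) (f := g) hBm hanti
    ⟨0, (L1.integrable_coeFn g).integrableOn⟩
  rw [hinter, setIntegral_empty] at hlim
  have h0 := ge_of_tendsto' hlim.norm hlow'
  rw [norm_zero] at h0
  linarith

end Noncompact

end CompactMultipliers

end GroupAlgebra

/-! ### The equivalence. -/

theorem theorem3p3 {G : Type*} [Group G] [TopologicalSpace G] [IsTopologicalGroup G]
    [LocallyCompactSpace G] [T2Space G] [MeasurableSpace G] [BorelSpace G]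
    (m : Measure G) [m.IsHaarMeasure] [m.Regular]
    (α : GroupAlgebra.L1 m →ₗ[ℂ] GroupAlgebra.L1 m)
    (hα : GroupAlgebra.IsContinuousEpimorphism m α)
    (μ : ComplexMeasure G) (hμ : GroupAlgebra.MemM μ) (hμ0 : μ ≠ 0) :
    [IsCompactOperator (GroupAlgebra.Lam m μ α),
      GroupAlgebra.IsWeaklyCompactOperator (GroupAlgebra.Lam m μ α),
      CompactSpace G ∧ ∃ φ : GroupAlgebra.L1 m, GroupAlgebra.toM m φ = μ].TFAE := by
  tfae_have 1 → 2 := fun h =>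
    GroupAlgebra.isWeaklyCompactOperator_of_isCompactOperator
      (T := (GroupAlgebra.convCLM m hμ).toLinearMap ∘ₗ α) h
  tfae_have 2 → 3 := fun h => by
    refine ⟨?_, GroupAlgebra.exists_toM_eq m hμ fun l _ hl =>
      GroupAlgebra.exists_ultrafilter_tendsto m hμ hα.continuous hα.surjective h l id hl⟩
    obtain ⟨φ, hφ⟩ := GroupAlgebra.exists_conv_ne_zero m hμ hμ0
    refine GroupAlgebra.compactSpace_of_forall_exists_ultrafilter m hφ fun y => ?_
    obtain ⟨u, hu, g, hg⟩ := GroupAlgebra.exists_ultrafilter_tendsto m hμ hα.continuous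
      hα.surjective h Filter.atTop (fun n => GroupAlgebra.rightTranslate m (y n) φ)
      (Filter.Eventually.of_forall fun n => GroupAlgebra.norm_rightTranslate_le m (y n) φ)
    simp only [GroupAlgebra.conv_rightTranslate m hμ] at hg
    exact ⟨u, hu, g, hg⟩
  tfae_have 3 → 1 := by
    rintro ⟨hG, φ, rfl⟩
    exact (GroupAlgebra.isCompactOperator_conv_toM m φ).comp_clm
      (⟨α, hα.continuous⟩ : GroupAlgebra.L1 m →L[ℂ] GroupAlgebra.L1 m)
  tfae_finish
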